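/- Let $k$ be a field and $G$ a finite group, and let $\mathrm{Sch}/k$ be the category of separated schemes of finite type over $k$. Regard $G$ as the constant group scheme over $k$, so that $G(T)$ is the group of locally constant maps $T\to G$ for $T\in \mathrm{Sch}/k$. A $G$-scheme is an object $X$ of $\mathrm{Sch}/k$ with an action of $G$, i.e. actions of $G(T)$ on $X(T)$ natural in $T$. A quotient $q\colon X\to X/G$ means a categorical quotient in $\mathrm{Sch}/k$: $q$ is $G$-invariant ($q(g.x)=q(x)$ for all $T$, $g\in G(T)$, $x\in X(T)$), and every $G$-invariant morphism $X\to Z$ in $\mathrm{Sch}/k$ factors uniquely through $q$. A commutative ring $A$ is seminormal if, whenever $b,c\in A$ satisfy $b^3=c^2$, there is $a\in A$ with $b=a^2$ and $c=a^3$; a scheme is seminormal if all its local rings are seminormal. A scheme over $k$ is quasi-projective if it admits an immersion over $k$ into some $\mathbb{P}^n_k$. (1) Let $X$ be an integral, quasi-projective, seminormal $G$-scheme. Then a quotient $q\colon X\to X/G$ exists in $\mathrm{Sch}/k$, and the scheme $X/G$ is seminormal (for every choice of the quotient). (2) Let $A$ be a seminormal integral domain on which $G$ acts by ring automorphisms.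 Then the invariant ring $A^G=\{a\in A \mid g.a=a \text{ for all } g\in G\}$ is seminormal. -/

import Mathlib

open CategoryTheory AlgebraicGeometry

universe u v w

/-- A commutative ring `A` is seminormal if, whenever `b ^ 3 = c ^ 2` in `A`, there is `a` in `A`
with `b = a ^ 2` and `c = a ^ 3`. -/
def IsSeminormalRing (A : Type v) [CommRing A] : Prop :=
  ∀ b c : A, b ^ 3 = c ^ 2 → ∃ a : A, b = a ^ 2 ∧ c = a ^ 3

/-- A scheme is seminormal if all its local rings are seminormal. -/
def IsSeminormalScheme (X : Scheme.{u}) : Prop :=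
  ∀ x : X, IsSeminormalRing (X.presheaf.stalk x)

/-- The property of a scheme over `k` of being separated and of finite type over `k`. -/
def isSeparatedFiniteType (k : Type u) [Field k] :
    ObjectProperty (Over (Spec (CommRingCat.of k))) :=
  fun X => AlgebraicGeometry.IsSeparated X.hom ∧ LocallyOfFiniteType X.hom ∧ QuasiCompact X.hom

/-- The category `Sch/k` of separated schemes of finite type over the field `k`
(with all morphisms over `k`). -/
abbrev SchOver (k : Type u) [Field k] := (isSeparatedFiniteType k).FullSubcategory

namespace SchOver

variable {k : Type u} [Field k]

/-- The underlying scheme. -/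
noncomputable abbrev scheme (X : SchOver k) : Scheme.{u} := X.obj.left

/-- The structure morphism to `Spec k`. -/
noncomputable abbrev structureHom (X : SchOver k) : X.scheme ⟶ Spec (CommRingCat.of k) := X.obj.hom

/-- The morphism of schemes underlying a morphism of `Sch/k`. -/
noncomputable abbrev schemeHom {X Y : SchOver k} (f : X ⟶ Y) : X.scheme ⟶ Y.scheme := f.hom.left

end SchOver

section ProjectiveSpace

attribute [local instance] MvPolynomial.gradedAlgebra

/-- Projective `n`-space over `k`: `Proj k[x₀, …, xₙ]` with the standard grading. -/
noncomputable def projSpace (k : Type u) [Field k] (n : ℕ) : Scheme.{u} :=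
  Proj (MvPolynomial.homogeneousSubmodule (Fin (n + 1)) k)

/-- The structure morphism of projective space over `k`. -/
noncomputable def projSpaceHom (k : Type u) [Field k] (n : ℕ) :
    projSpace k n ⟶ Spec (CommRingCat.of k) :=
  Proj.toSpecZero (MvPolynomial.homogeneousSubmodule (Fin (n + 1)) k) ≫
    Spec.map (CommRingCat.ofHom
      (algebraMap k (MvPolynomial.homogeneousSubmodule (Fin (n + 1)) k 0)))

end ProjectiveSpace

/-- `X` is quasi-projective over `k`: it admits a (locally closed) immersion over `k` into some
projective space over `k`. -/
def IsQuasiProjective {k : Type u} [Field k] (X : SchOver k) : Prop :=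
  ∃ (n : ℕ) (i : X.scheme ⟶ projSpace k n), IsImmersion i ∧ i ≫ projSpaceHom k n = X.structureHom

/-- The group `G_k(T)` of locally constant maps `T → G`, i.e. of `T`-valued points of the constant
group scheme `∐_{g ∈ G} Spec k`. -/
abbrev ConstGroupPoints {k : Type u} [Field k] (G : Type w) (T : SchOver k) :=
  LocallyConstant T.scheme G

/-- The map `G_k(T) → G_k(T')`, `g ↦ g ∘ f`, induced by a morphism `f : T' ⟶ T` of `Sch/k`. -/
noncomputable def ConstGroupPoints.pullback {k : Type u} [Field k] {G : Type w} {T' T : SchOver k} (f : T' ⟶ T)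
    (g : ConstGroupPoints G T) : ConstGroupPoints G T' :=
  LocallyConstant.comap ⟨SchOver.schemeHom f, (SchOver.schemeHom f).continuous⟩ g

/-- An action of the constant group scheme `G_k` on `X`, by its functor of points: actions of the
groups `G_k(T)` on the sets `X(T)`, natural in `T`. (By the Yoneda lemma the natural maps
`G_k(T) × X(T) → X(T)` are the same thing as a morphism `G_k × X ⟶ X` in `Sch/k` when `G` is
finite.) -/
structure SchemeAction {k : Type u} [Field k] (G : Type w) [Group G] (X : SchOver k) where
  /-- `(g, x) ↦ g.x` on `T`-valued points -/
  act : ∀ {T : SchOver k}, ConstGroupPoints G T → (T ⟶ X) → (T ⟶ X)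
  one_act : ∀ {T : SchOver k} (x : T ⟶ X), act 1 x = x
  mul_act : ∀ {T : SchOver k} (g h : ConstGroupPoints G T) (x : T ⟶ X),
    act (g * h) x = act g (act h x)
  comp_act : ∀ {T' T : SchOver k} (f : T' ⟶ T) (g : ConstGroupPoints G T) (x : T ⟶ X),
    f ≫ act g x = act (ConstGroupPoints.pullback f g) (f ≫ x)

namespace SchemeAction

variable {k : Type u} [Field k] {G : Type w} [Group G] {X : SchOver k}

/-- `q : X ⟶ Y` is `G`-invariant: `q(g.x) = q(x)` for all `g ∈ G_k(T)` and `x ∈ X(T)`. -/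
def IsInvariant (σ : SchemeAction G X) {Y : SchOver k} (q : X ⟶ Y) : Prop :=
  ∀ (T : SchOver k) (g : ConstGroupPoints G T) (x : T ⟶ X), σ.act g x ≫ q = x ≫ q

/-- `q : X ⟶ Y` is a categorical quotient of `X` by `G` in `Sch/k`: it is `G`-invariant, and every
`G`-invariant morphism out of `X` factors uniquely through it. -/
structure IsCategoricalQuotient (σ : SchemeAction G X) {Y : SchOver k} (q : X ⟶ Y) : Prop where
  invariant : σ.IsInvariant q
  universal : ∀ (Z : SchOver k) (q' : X ⟶ Z), σ.IsInvariant q' → ∃! α : Y ⟶ Z, q ≫ α = q'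

end SchemeAction

/-! In a domain the element `a` with `b = a ^ 2` and `c = a ^ 3` is unique. If `b` and `c` are fixed
by `G`, every `g • a` has the same square and cube as `a`, hence equals `a`. This is (2).

For (1), quasi-projectivity puts every finite set of points, in particular every orbit, into an
affine open (homogeneous prime avoidance). Intersecting the translates of that open gives, by
separatedness, a cover by invariant affine opens `U`. The spectra of the invariant rings of `Γ(X,
U)` glue, because invariants commute with localization at invariant elements and the fibres over
each such spectrum are the orbits.

The glued map is surjective and universally closed with reduced target, so it can be cancelled in
front of morphisms to separated schemes; this yields the universal property. Surjectivity and
closedness also pass quasi-compactness and separatedness on to the quotient, and finite type is the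
Artin–Tate argument. For domains seminormality can be checked on local rings, so (2) on each chart
makes the quotient seminormal. Uniqueness of categorical quotients extends this to every choice. -/

/-! ### Seminormal domains: invariants, localization, local-to-global. -/

section Seminormal

theorem IsSeminormalRing.of_ringEquiv {A : Type u} {B : Type v} [CommRing A] [CommRing B]
    (e : A ≃+* B) (h : IsSeminormalRing A) : IsSeminormalRing B := by
  intro b c hbc
  obtain ⟨a, hb, hc⟩ := h (e.symm b) (e.symm c) (by rw [← map_pow, ← map_pow, hbc])
  exact ⟨e a, by rw [← map_pow, ← hb, e.apply_symm_apply],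
    by rw [← map_pow, ← hc, e.apply_symm_apply]⟩

/-- In a domain, an element is determined by its square and its cube. -/
theorem eq_of_sq_eq_sq_of_cube_eq_cube {A : Type u} [CommRing A] [IsDomain A] {x y : A}
    (h2 : x ^ 2 = y ^ 2) (h3 : x ^ 3 = y ^ 3) : x = y := by
  by_cases hx : x = 0
  · subst hx
    rw [zero_pow two_ne_zero] at h2
    exact (eq_zero_of_pow_eq_zero h2.symm).symm
  · refine mul_left_cancel₀ (pow_ne_zero 2 hx) ?_
    calc x ^ 2 * x = x ^ 3 := by ring
      _ = y ^ 2 * y := by rw [h3]; ring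
      _ = x ^ 2 * y := by rw [h2]

theorem IsSeminormalRing.fixedPoints {A : Type v} [CommRing A] [IsDomain A] {G : Type w} [Group G]
    [MulSemiringAction G A] (h : IsSeminormalRing A) :
    IsSeminormalRing (FixedPoints.subring A G) := by
  intro b c hbc
  obtain ⟨a, hb, hc⟩ := h b c (by exact_mod_cast congrArg Subtype.val hbc)
  refine ⟨⟨a, fun g => eq_of_sq_eq_sq_of_cube_eq_cube ?_ ?_⟩, Subtype.ext hb, Subtype.ext hc⟩
  · rw [← smul_pow', ← hb]; exact b.2 g
  · rw [← smul_pow', ← hc]; exact c.2 g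

theorem IsSeminormalRing.isLocalization {A : Type u} {S : Type v} [CommRing A] [CommRing S]
    [IsDomain A] [Algebra A S] (M : Submonoid A) [IsLocalization M S] (hM : M ≤ nonZeroDivisors A)
    (h : IsSeminormalRing A) : IsSeminormalRing S := by
  intro b c hbc
  obtain ⟨s, hs⟩ := IsLocalization.exist_integer_multiples_of_finite M ![b, c]
  obtain ⟨x, hx⟩ := hs 0
  obtain ⟨y, hy⟩ := hs 1
  simp only [Matrix.cons_val_zero, Matrix.cons_val_one] at hx hy
  have hinj := IsLocalization.injective S hM
  have hu : IsUnit (algebraMap A S s) := IsLocalization.map_units S s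
  rw [Algebra.smul_def] at hx hy
  -- Since `x = s b` and `y = s c` in `S`, these are `s ^ 2 b` and `s ^ 3 c`: weights 2 and 3
  -- preserve the cuspidal relation, and the root is then divided by `s`.
  obtain ⟨a, ha2, ha3⟩ := h (x * s) (y * s ^ 2) (hinj (by
    simp only [map_pow, map_mul, hx, hy]
    linear_combination (algebraMap A S s) ^ 6 * hbc))
  obtain ⟨t, ht⟩ := hu.exists_right_inv
  have e2 := congrArg (algebraMap A S) ha2
  have e3 := congrArg (algebraMap A S) ha3
  simp only [map_pow, map_mul, hx, hy] at e2 e3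
  refine ⟨algebraMap A S a * t, ?_, ?_⟩
  · refine (hu.pow 2).mul_left_cancel ?_
    linear_combination e2 - (algebraMap A S a) ^ 2 * (algebraMap A S s * t + 1) * ht
  · refine (hu.pow 3).mul_left_cancel ?_
    linear_combination e3 - (algebraMap A S a) ^ 3 *
      ((algebraMap A S s * t) ^ 2 + algebraMap A S s * t + 1) * ht

/-- Seminormality of a domain can be checked on its localizations at prime ideals. -/
theorem IsSeminormalRing.of_localizations {A : Type u} [CommRing A] [IsDomain A]
    (h : ∀ (p : Ideal A) [p.IsPrime], IsSeminormalRing (Localization.AtPrime p)) :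
    IsSeminormalRing A := by
  intro b c hbc
  by_cases hb : b = 0
  · subst hb
    refine ⟨0, by simp, ?_⟩
    rw [zero_pow three_ne_zero] at hbc
    rw [eq_zero_of_pow_eq_zero hbc.symm, zero_pow three_ne_zero]
  -- It is enough that `b` divides `c`: if `c = b * a`, cancelling `b ^ 2` in `b ^ 3 = c ^ 2` gives
  -- `b = a ^ 2`. Divisibility is a local condition.
  suffices hI : (Ideal.span {b}).colon {c} = ⊤ by
    have h1 : (1 : A) ∈ (Ideal.span {b}).colon {c} := hI ▸ Submodule.mem_top
    rw [Submodule.mem_colon_singleton, one_smul, Ideal.mem_span_singleton] at h1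
    obtain ⟨a, rfl⟩ := h1
    have ha : b = a ^ 2 := mul_left_cancel₀ (pow_ne_zero 2 hb) (by linear_combination hbc)
    exact ⟨a, ha, by linear_combination a * ha⟩
  by_contra hI
  obtain ⟨m, hm, hle⟩ := Ideal.exists_le_maximal _ hI
  let φ := algebraMap A (Localization.AtPrime m)
  have hinj : Function.Injective φ :=
    IsLocalization.injective _ m.primeCompl_le_nonZeroDivisors
  obtain ⟨α, h2, h3⟩ := h m (φ b) (φ c) (by rw [← map_pow, ← map_pow, hbc])
  obtain ⟨⟨x, s⟩, hx⟩ := IsLocalization.surj m.primeCompl α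
  -- Writing `α = x / s`, the identity `s α ^ 3 = α ^ 2 x` says `s * c = b * x`, so the denominator
  -- `s` lies in the colon ideal.
  refine s.2 (hle ?_)
  rw [Submodule.mem_colon_singleton, smul_eq_mul, Ideal.mem_span_singleton]
  refine ⟨x, hinj ?_⟩
  rw [map_mul, map_mul, h2, h3]
  linear_combination α ^ 2 * hx

end Seminormal

/-! ### Rings of invariants of finite groups. -/

section FixedPoints

variable {A C : Type*} [CommRing A] [CommRing C] {G : Type*} [Group G] [MulSemiringAction G A]
  [MulSemiringAction G C]

instance isInvariant_fixedPoints : Algebra.IsInvariant (FixedPoints.subring A G) A G where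
  isInvariant b hb := ⟨⟨b, hb⟩, rfl⟩

/-- The ring homomorphism between the rings of invariants induced by an equivariant ring
homomorphism. -/
def fixedPointsMap (φ : A →+* C) (hφ : ∀ (g : G) a, φ (g • a) = g • φ a) :
    FixedPoints.subring A G →+* FixedPoints.subring C G :=
  (φ.comp (FixedPoints.subring A G).subtype).codRestrict _ fun a g => by
    simpa using (hφ g a).symm.trans (congrArg φ (a.2 g))

/-- The formation of rings of invariants of finite groups commutes with localization at invariant
elements. -/
theorem isLocalizationAway_fixedPointsMap [Finite G] (φ : A →+* C)
    (hφ : ∀ (g : G) a, φ (g • a) = g • φ a) (h : FixedPoints.subring A G)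
    (hloc : letI := φ.toAlgebra; IsLocalization.Away (h : A) C) :
    letI := (fixedPointsMap φ hφ).toAlgebra
    IsLocalization.Away h (FixedPoints.subring C G) := by
  let := φ.toAlgebra
  let := (fixedPointsMap φ hφ).toAlgebra
  have hu : IsUnit (φ h) := IsLocalization.Away.algebraMap_isUnit (h : A)
  -- An element that is invariant only after localization becomes invariant once multiplied by a
  -- power of `h`; finiteness of `G` bounds the exponent.
  have key (a : A) (ha : ∀ g : G, φ (g • a) = φ a) :
      ∃ m : ℕ, ∀ g : G, g • ((h : A) ^ m * a) = (h : A) ^ m * a := by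
    have (g : G) : ∃ m : ℕ, (h : A) ^ m * (g • a) = (h : A) ^ m * a :=
      IsLocalization.Away.exists_of_eq (S := C) (h : A) (ha g)
    choose m hm using this
    obtain ⟨N, hN⟩ := (Set.finite_range m).bddAbove
    refine ⟨N, fun g => ?_⟩
    obtain ⟨d, hd⟩ := Nat.exists_eq_add_of_le (hN ⟨g, rfl⟩)
    rw [smul_mul', smul_pow', h.2 g, hd, pow_add]
    linear_combination (h : A) ^ d * hm g
  obtain ⟨t, ht⟩ := hu.exists_right_inv
  have htinv (g : G) : g • t = t := hu.mul_left_cancel <| by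
    conv_lhs => rw [← h.2 g, hφ, ← smul_mul', ht, smul_one, ← ht]
  refine IsLocalization.Away.mk h ?_ (fun c => ?_) (fun a b hab => ?_)
  · exact IsUnit.of_mul_eq_one ⟨t, htinv⟩ (Subtype.ext ht)
  · obtain ⟨n, a, hna⟩ := IsLocalization.Away.surj (h : A) (c : C)
    change c * φ h ^ n = φ a at hna
    obtain ⟨m, hm⟩ := key a fun g => by
      rw [hφ, ← hna, smul_mul', smul_pow', c.2 g, ← hφ, h.2 g]
    refine ⟨m + n, ⟨_, hm⟩, Subtype.ext ?_⟩
    change (c : C) * φ h ^ (m + n) = φ (h ^ m * a)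
    rw [map_mul, map_pow, ← hna]
    ring
  · obtain ⟨n, hn⟩ := IsLocalization.Away.exists_of_eq (S := C) (h : A) (congrArg Subtype.val hab)
    exact ⟨n, Subtype.ext (by simpa using hn)⟩

/-- Rings of invariants of finite groups are of finite type over Noetherian base rings. -/
theorem finiteType_fixedPoints {k : Type*} [CommRing k] [IsNoetherianRing k] [Finite G]
    (φ : k →+* FixedPoints.subring A G)
    (hφ : ((FixedPoints.subring A G).subtype.comp φ).FiniteType) : φ.FiniteType := by
  algebraize [φ, (FixedPoints.subring A G).subtype.comp φ]
  have : IsScalarTower k (FixedPoints.subring A G) A := .of_algebraMap_eq fun _ => rfl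
  -- Artin–Tate: `A` is integral and of finite type over the invariants, hence a finite module, so
  -- finite generation over `k` descends.
  have := Algebra.IsInvariant.isIntegral (FixedPoints.subring A G) A G
  have : Algebra.FiniteType (FixedPoints.subring A G) A := .of_restrictScalars_finiteType k _ A
  have : Module.Finite (FixedPoints.subring A G) A := Algebra.IsIntegral.finite
  exact ⟨fg_of_fg_of_fg k _ A Algebra.FiniteType.out Module.Finite.fg_top
    Subtype.val_injective⟩

end FixedPoints

/-! ### Homogeneous prime avoidance and finite sets of points in `Proj`. -/

section Proj

open TopologicalSpace

variable {A : Type u} {σ : Type*} [CommRing A] [SetLike σ A] [AddSubgroupClass σ A] (𝒜 : ℕ → σ)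
  [GradedRing 𝒜]

theorem HomogeneousIdeal.exists_homogeneous_mem_notMem {I J : HomogeneousIdeal 𝒜} (h : ¬ I ≤ J) :
    ∃ (n : ℕ) (a : A), a ∈ 𝒜 n ∧ a ∈ I ∧ a ∉ J := by
  obtain ⟨a, haI, haJ⟩ := Set.not_subset.mp h
  classical
  by_contra! H
  refine haJ ?_
  rw [← DirectSum.sum_support_decompose 𝒜 a]
  exact sum_mem fun i _ => H i _ (SetLike.coe_mem _) (I.isHomogeneous i haI)

theorem ProjectiveSpectrum.exists_homogeneous_of_mem_opens (O : (Proj 𝒜).Opens) {x : Proj 𝒜}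
    (hx : x ∈ O) : ∃ (m : ℕ) (f : A), 0 < m ∧ f ∈ 𝒜 m ∧ f ∉ x.asHomogeneousIdeal ∧
      ∀ z : Proj 𝒜, z ∉ O → f ∈ z.asHomogeneousIdeal := by
  obtain ⟨_, ⟨f, rfl⟩, hxf, hfO⟩ := Opens.isBasis_iff_nbhd.mp (Proj.isBasis_basicOpen 𝒜) hx
  rw [Proj.basicOpen_eq_iSup_proj, Opens.mem_iSup] at hxf
  obtain ⟨i, hi⟩ := hxf
  -- The component of `f` may have degree 0; a factor of positive degree not vanishing at `x` exists
  -- because `x` does not contain the irrelevant ideal.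
  obtain ⟨j, b, hj, hb, hbx⟩ : ∃ (n : ℕ) (a : A), 0 < n ∧ a ∈ 𝒜 n ∧ a ∉ x.asHomogeneousIdeal := by
    obtain ⟨n, a, ha, hairr, hax⟩ :=
      HomogeneousIdeal.exists_homogeneous_mem_notMem 𝒜 x.not_irrelevant_le
    refine ⟨n, a, Nat.pos_of_ne_zero ?_, ha, hax⟩
    rintro rfl
    rw [HomogeneousIdeal.mem_irrelevant_iff, GradedRing.proj_apply,
      DirectSum.decompose_of_mem_same _ ha] at hairr
    exact hax (hairr ▸ zero_mem _)
  refine ⟨i + j, GradedRing.proj 𝒜 i f * b, by omega, SetLike.mul_mem_graded (SetLike.coe_mem _) hb,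
    fun h => (x.isPrime.mem_or_mem h).elim hi hbx, fun z hz => ?_⟩
  refine Ideal.mul_mem_right _ _ (z.asHomogeneousIdeal.isHomogeneous i ?_)
  by_contra h
  exact hz (hfO h)

/-- Homogeneous prime avoidance: finitely many points in an open subset of `Proj` admit a common
basic open neighbourhood. -/
theorem ProjectiveSpectrum.exists_homogeneous_of_finset_subset (O : (Proj 𝒜).Opens)
    (s : Finset (Proj 𝒜)) (hs : ∀ x ∈ s, x ∈ O) : ∃ (m : ℕ) (f : A), 0 < m ∧ f ∈ 𝒜 m ∧
      (∀ x ∈ s, f ∉ x.asHomogeneousIdeal) ∧ ∀ z : Proj 𝒜, z ∉ O → f ∈ z.asHomogeneousIdeal := by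
  classical
  induction s using Finset.strongInduction with
  | H s ih =>
  -- If `p ≤ x`, avoiding `x` already avoids `p`, so `p` can be dropped and the remaining primes are
  -- pairwise incomparable.
  by_cases hle : ∃ p ∈ s, ∃ x ∈ s, p ≠ x ∧ p.asHomogeneousIdeal ≤ x.asHomogeneousIdeal
  · obtain ⟨p, hp, x, hx, hne, hpx⟩ := hle
    obtain ⟨m, f, hm, hf, hfs, hfO⟩ := ih (s.erase p) (Finset.erase_ssubset hp)
      fun y hy => hs y (Finset.mem_of_mem_erase hy)
    refine ⟨m, f, hm, hf, fun y hy hfy => ?_, hfO⟩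
    by_cases hyp : y = p
    · exact hfs x (Finset.mem_erase.mpr ⟨hne.symm, hx⟩) (hpx (hyp ▸ hfy))
    · exact hfs y (Finset.mem_erase.mpr ⟨hyp, hy⟩) hfy
  obtain rfl | ⟨x, hx⟩ := s.eq_empty_or_nonempty
  · exact ⟨1, 0, one_pos, zero_mem _, by simp, fun z _ => zero_mem _⟩
  obtain ⟨d, f, hd, hf, hfs, hfO⟩ := ih (s.erase x) (Finset.erase_ssubset hx)
    fun y hy => hs y (Finset.mem_of_mem_erase hy)
  by_cases hfx : f ∈ x.asHomogeneousIdeal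
  swap
  · refine ⟨d, f, hd, hf, fun y hy hfy => ?_, hfO⟩
    by_cases hyx : y = x
    · exact hfx (hyx ▸ hfy)
    · exact hfs y (Finset.mem_erase.mpr ⟨hyx, hy⟩) hfy
  obtain ⟨e₀, g₀, he₀, hg₀, hg₀x, hg₀O⟩ := exists_homogeneous_of_mem_opens 𝒜 O (hs x hx)
  have (p : Proj 𝒜) : ∃ (n : ℕ) (b : A), b ∈ 𝒜 n ∧
      (p ∈ s.erase x → b ∈ p.asHomogeneousIdeal) ∧ b ∉ x.asHomogeneousIdeal := by
    by_cases hp : p ∈ s.erase x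
    · obtain ⟨n, b, hb, hbp, hbx⟩ := HomogeneousIdeal.exists_homogeneous_mem_notMem 𝒜
        (I := p.asHomogeneousIdeal) (J := x.asHomogeneousIdeal) fun h =>
          hle ⟨p, Finset.mem_of_mem_erase hp, x, hx, Finset.ne_of_mem_erase hp, h⟩
      exact ⟨n, b, hb, fun _ => hbp, hbx⟩
    · exact ⟨e₀, g₀, hg₀, fun h => absurd h hp, hg₀x⟩
  choose n b hb hbp hbx using this
  let e := e₀ + ∑ p ∈ s.erase x, n p
  let g := g₀ * ∏ p ∈ s.erase x, b p
  have he : 0 < e := by omega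
  have hg : g ∈ 𝒜 e := SetLike.mul_mem_graded hg₀ (SetLike.prod_mem_graded _ _ _ fun p _ => hb p)
  have hgx : g ∉ x.asHomogeneousIdeal := fun h => (x.isPrime.mem_or_mem h).elim hg₀x fun h =>
    let ⟨p, _, h⟩ := (x.isPrime.prod_mem_iff).mp h
    hbx p h
  have hgs (p) (hp : p ∈ s.erase x) : g ∈ p.asHomogeneousIdeal :=
    Ideal.mul_mem_left _ _ (Ideal.mem_of_dvd _ (Finset.dvd_prod_of_mem b hp) (hbp p hp))
  -- The exponents equalize degrees. At `x` only `g` survives, at the other points only `f`.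
  refine ⟨d * e, f ^ e + g ^ d, by positivity, add_mem ?_ ?_, fun y hy h => ?_, fun z hz => ?_⟩
  · rw [mul_comm]; exact SetLike.pow_mem_graded e hf
  · exact SetLike.pow_mem_graded d hg
  · by_cases hyx : y = x
    · subst hyx
      exact hgx (y.isPrime.mem_of_pow_mem d
        ((Ideal.add_mem_iff_right _ (Ideal.pow_mem_of_mem _ hfx e he)).mp h))
    · have hy := Finset.mem_erase.mpr ⟨hyx, hy⟩
      exact hfs y hy (y.isPrime.mem_of_pow_mem e
        ((Ideal.add_mem_iff_left _ (Ideal.pow_mem_of_mem _ (hgs y hy) d hd)).mp h))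
  · exact Ideal.add_mem _ (Ideal.pow_mem_of_mem _ (hfO z hz) e he)
      (Ideal.pow_mem_of_mem _ (Ideal.mul_mem_right _ _ (hg₀O z hz)) d hd)

/-- Finite sets of points of a quasi-projective scheme are contained in affine opens. -/
theorem exists_isAffineOpen_of_isImmersion_proj {X : Scheme.{u}} (i : X ⟶ Proj 𝒜) [IsImmersion i]
    (s : Finset X) : ∃ U : X.Opens, IsAffineOpen U ∧ ∀ x ∈ s, x ∈ U := by
  classical
  obtain ⟨m, f, hm, hf, hfs, hfO⟩ := ProjectiveSpectrum.exists_homogeneous_of_finset_subset 𝒜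
    i.coborderRange (s.image i) (by
      simp only [Finset.mem_image, forall_exists_index, and_imp, forall_apply_eq_imp_iff₂]
      exact fun x _ => subset_coborder ⟨x, rfl⟩)
  -- `i` is a closed immersion into its coborder, so the preimage of an affine open contained in the
  -- coborder is affine.
  have hle : Proj.basicOpen 𝒜 f ≤ i.coborderRange := fun z hz => by
    by_contra h
    exact hz (hfO z h)
  have haff : IsAffineOpen (i.coborderRange.ι ⁻¹ᵁ Proj.basicOpen 𝒜 f) :=
    (Proj.isAffineOpen_basicOpen 𝒜 f hf hm).preimage_of_isOpenImmersion _ (by simpa using hle)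
  refine ⟨i ⁻¹ᵁ Proj.basicOpen 𝒜 f, ?_, fun x hx => hfs _ (Finset.mem_image_of_mem _ hx)⟩
  have := haff.preimage i.liftCoborder
  rwa [← Scheme.Hom.comp_preimage, Scheme.Hom.liftCoborder_ι] at this

end Proj

theorem IsQuasiProjective.exists_isAffineOpen {k : Type u} [Field k] {X : SchOver k}
    (hX : IsQuasiProjective X) (s : Finset X.scheme) :
    ∃ U : X.scheme.Opens, IsAffineOpen U ∧ ∀ x ∈ s, x ∈ U := by
  obtain ⟨n, i, hi, -⟩ := hX
  let := MvPolynomial.gradedAlgebra (σ := Fin (n + 1)) (R := k)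
  exact @exists_isAffineOpen_of_isImmersion_proj _ _ _ _ _
    (MvPolynomial.homogeneousSubmodule (Fin (n + 1)) k) _ _ i hi s

/-! ### Group actions on schemes and their invariant affine opens. -/

open CategoryTheory.Limits TopologicalSpace

lemma AlgebraicGeometry.Scheme.Hom.appLE_apply_of_eq_id {X : Scheme.{u}} {f : X ⟶ X} (hf : f = 𝟙 X)
    {U : X.Opens} (e : U ≤ f ⁻¹ᵁ U) (s : Γ(X, U)) : f.appLE U U e s = s := by
  subst hf
  rw [Scheme.Hom.appLE, Scheme.Hom.id_app]
  exact congr($(X.presheaf.map_id (Opposite.op U)) s)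

/-- A (left) action of an abstract group on a scheme by automorphisms. -/
structure SchemeGroupAction (G : Type w) [Group G] (X : Scheme.{u}) where
  /-- the automorphism of `X` given by an element of the group -/
  hom : G → (X ⟶ X)
  hom_one : hom 1 = 𝟙 X
  hom_mul (g h : G) : hom (g * h) = hom h ≫ hom g

namespace SchemeGroupAction

variable {G : Type w} [Group G] {X : Scheme.{u}} (ρ : SchemeGroupAction G X)

/-- An open subset is invariant under the action. -/
def IsInvariantOpen (U : X.Opens) : Prop := ∀ g : G, U ≤ ρ.hom g ⁻¹ᵁ U

/-- Invariant affine open subsets. -/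
@[ext]
structure InvariantAffineOpen where
  /-- the underlying open subset -/
  carrier : X.Opens
  isAffineOpen : IsAffineOpen carrier
  isInvariantOpen : ρ.IsInvariantOpen carrier

variable {ρ}

lemma hom_inv_apply (g : G) (x : X) : ρ.hom g⁻¹ (ρ.hom g x) = x := by
  rw [← Scheme.Hom.comp_apply, ← ρ.hom_mul, inv_mul_cancel, ρ.hom_one]
  rfl

lemma IsInvariantOpen.hom_apply_mem_iff {U : X.Opens} (hU : ρ.IsInvariantOpen U) (g : G) {x : X} :
    ρ.hom g x ∈ U ↔ x ∈ U :=
  ⟨fun h => hom_inv_apply (ρ := ρ) g x ▸ hU g⁻¹ h, fun h => hU g h⟩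

lemma IsInvariantOpen.inf {U V : X.Opens} (hU : ρ.IsInvariantOpen U) (hV : ρ.IsInvariantOpen V) :
    ρ.IsInvariantOpen (U ⊓ V) := fun g _ hx => ⟨hU g hx.1, hV g hx.2⟩

lemma isInvariantOpen_preimage {Z : Scheme.{u}} {f : X ⟶ Z} (hf : ∀ g, ρ.hom g ≫ f = f)
    (V : Z.Opens) : ρ.IsInvariantOpen (f ⁻¹ᵁ V) := fun g => by
  rw [← Scheme.Hom.comp_preimage, hf]

namespace InvariantAffineOpen

instance : PartialOrder ρ.InvariantAffineOpen :=
  PartialOrder.lift carrier fun _ _ => InvariantAffineOpen.ext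

lemma le_def {U V : ρ.InvariantAffineOpen} : U ≤ V ↔ U.carrier ≤ V.carrier := Iff.rfl

instance (U : ρ.InvariantAffineOpen) : MulSemiringAction G Γ(X, U.carrier) where
  -- Pullback of functions is contravariant; the inverse turns it into a left action.
  smul g s := (ρ.hom g⁻¹).appLE U.carrier U.carrier (U.isInvariantOpen _) s
  one_smul s := by
    change (ρ.hom 1⁻¹).appLE U.carrier U.carrier (U.isInvariantOpen _) s = s
    exact Scheme.Hom.appLE_apply_of_eq_id (by rw [inv_one, ρ.hom_one]) _ s
  mul_smul g h s := by
    change (ρ.hom (g * h)⁻¹).appLE U.carrier U.carrier (U.isInvariantOpen _) s =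
      (ρ.hom g⁻¹).appLE U.carrier U.carrier (U.isInvariantOpen _)
        ((ρ.hom h⁻¹).appLE U.carrier U.carrier (U.isInvariantOpen _) s)
    simp only [mul_inv_rev, ρ.hom_mul]
    rw [← Scheme.Hom.appLE_comp_appLE _ _ _ U.carrier _ (U.isInvariantOpen _)
      (U.isInvariantOpen _)]
    rfl
  smul_zero g := map_zero ((ρ.hom g⁻¹).appLE U.carrier U.carrier (U.isInvariantOpen _)).hom
  smul_add g := map_add ((ρ.hom g⁻¹).appLE U.carrier U.carrier (U.isInvariantOpen _)).hom
  smul_one g := map_one ((ρ.hom g⁻¹).appLE U.carrier U.carrier (U.isInvariantOpen _)).hom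
  smul_mul g := map_mul ((ρ.hom g⁻¹).appLE U.carrier U.carrier (U.isInvariantOpen _)).hom

lemma smul_def (U : ρ.InvariantAffineOpen) (g : G) (s : Γ(X, U.carrier)) :
    g • s = (ρ.hom g⁻¹).appLE U.carrier U.carrier (U.isInvariantOpen _) s := rfl

/-- The ring of invariant functions on an invariant affine open subset. -/
abbrev invariants (U : ρ.InvariantAffineOpen) : Subring Γ(X, U.carrier) :=
  FixedPoints.subring Γ(X, U.carrier) G

lemma appLE_invariant (U : ρ.InvariantAffineOpen) (g : G) (s : U.invariants) :
    (ρ.hom g).appLE U.carrier U.carrier (U.isInvariantOpen _) s = s.1 := by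
  have := s.2 g⁻¹
  simpa only [smul_def, inv_inv] using this

lemma mem_invariants_iff (U : ρ.InvariantAffineOpen) (s : Γ(X, U.carrier)) :
    s ∈ U.invariants ↔
      ∀ g, (ρ.hom g).appLE U.carrier U.carrier (U.isInvariantOpen _) s = s :=
  ⟨fun h g => U.appLE_invariant g ⟨s, h⟩, fun h g => h g⁻¹⟩

/-- The inclusion of the ring of invariant functions. -/
abbrev inclusion (U : ρ.InvariantAffineOpen) : CommRingCat.of U.invariants ⟶ Γ(X, U.carrier) :=
  CommRingCat.ofHom U.invariants.subtype

lemma map_smul {U V : ρ.InvariantAffineOpen} (h : U ≤ V) (g : G) (s : Γ(X, V.carrier)) :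
    X.presheaf.map (homOfLE (le_def.mp h)).op (g • s) =
      g • X.presheaf.map (homOfLE (le_def.mp h)).op s := by
  simp only [smul_def, ← CommRingCat.comp_apply]
  rw [Scheme.Hom.appLE_map, Scheme.Hom.map_appLE]

/-- Restriction of invariant functions. -/
noncomputable abbrev restrict {U V : ρ.InvariantAffineOpen} (h : U ≤ V) :
    V.invariants →+* U.invariants :=
  fixedPointsMap (X.presheaf.map (homOfLE (le_def.mp h)).op).hom (map_smul h)

variable (ρ) in
/-- The diagram of quotients of the invariant affine open subsets. -/
noncomputable def quotientFunctor : ρ.InvariantAffineOpen ⥤ Scheme.{u} where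
  obj U := Spec (CommRingCat.of U.invariants)
  map h := Spec.map (CommRingCat.ofHom (restrict h.le))
  map_id U := by
    rw [← Spec.map_id]
    congr 1
    exact CommRingCat.hom_ext (RingHom.ext fun s => Subtype.ext
      congr($(X.presheaf.map_id (Opposite.op U.carrier)) s.1))
  map_comp f g := by
    rw [← Spec.map_comp]
    congr 1
    exact CommRingCat.hom_ext (RingHom.ext fun s => Subtype.ext
      congr($(X.presheaf.map_comp (homOfLE (le_def.mp g.le)).op (homOfLE (le_def.mp f.le)).op) s.1))

/-- The quotient map of an invariant affine open subset. -/
noncomputable def toQuotient (U : ρ.InvariantAffineOpen) :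
    U.carrier.toScheme ⟶ (quotientFunctor ρ).obj U :=
  U.carrier.toSpecΓ ≫ Spec.map U.inclusion

lemma homOfLE_toQuotient {U V : ρ.InvariantAffineOpen} (h : U ⟶ V) :
    X.homOfLE h.le ≫ V.toQuotient = U.toQuotient ≫ (quotientFunctor ρ).map h := by
  simp only [toQuotient, quotientFunctor, Category.assoc, ← Spec.map_comp]
  rw [← Scheme.Opens.toSpecΓ_SpecMap_presheaf_map_assoc _ _ h.le, ← Spec.map_comp]
  rfl

lemma quotientFunctor_map_toQuotient_apply {U V : ρ.InvariantAffineOpen} (h : U ⟶ V)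
    (x : U.carrier.toScheme) :
    (quotientFunctor ρ).map h (U.toQuotient x) = V.toQuotient (X.homOfLE h.le x) :=
  congr($(homOfLE_toQuotient h) x).symm

lemma resLE_toQuotient (U : ρ.InvariantAffineOpen) (g : G) :
    (ρ.hom g).resLE U.carrier U.carrier (U.isInvariantOpen g) ≫ U.toQuotient = U.toQuotient := by
  have : (ρ.hom g).resLE U.carrier U.carrier (U.isInvariantOpen g) ≫ U.carrier.toSpecΓ ≫
      Spec.map U.inclusion = U.carrier.toSpecΓ ≫ Spec.map U.inclusion := by
    rw [← Scheme.Opens.toSpecΓ_SpecMap_appLE_assoc, ← Spec.map_comp]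
    congr 2
    ext s
    exact U.appLE_invariant g s
  exact this

section Finite

variable [Finite G]

instance (U : ρ.InvariantAffineOpen) : IsIntegralHom (Spec.map U.inclusion) :=
  IsIntegralHom.SpecMap_iff.mpr (Algebra.IsInvariant.isIntegral U.invariants _ G).1

instance (U : ρ.InvariantAffineOpen) : IsIso U.carrier.toSpecΓ := by
  rw [← U.isAffineOpen.isoSpec_hom]
  infer_instance

instance (U : ρ.InvariantAffineOpen) : IsIntegralHom U.toQuotient :=
  inferInstanceAs (IsIntegralHom (U.carrier.toSpecΓ ≫ Spec.map U.inclusion))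

instance (U : ρ.InvariantAffineOpen) : Surjective U.toQuotient := by
  have := Algebra.IsInvariant.isIntegral U.invariants Γ(X, U.carrier) G
  have : Surjective (Spec.map U.inclusion) :=
    ⟨RingHom.IsIntegral.comap_surjective this.1 Subtype.val_injective⟩
  exact inferInstanceAs (Surjective (U.carrier.toSpecΓ ≫ Spec.map U.inclusion))

/-- The fibres of the quotient map are the orbits. -/
lemma toQuotient_apply_eq_iff (U : ρ.InvariantAffineOpen) (x y : U.carrier.toScheme) :
    U.toQuotient x = U.toQuotient y ↔ ∃ g, ρ.hom g (U.carrier.ι x) = U.carrier.ι y := by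
  have key (g : G) : ρ.hom g (U.carrier.ι x) =
      U.carrier.ι ((ρ.hom g).resLE U.carrier U.carrier (U.isInvariantOpen g) x) := by
    rw [← Scheme.Hom.comp_apply, ← Scheme.Hom.comp_apply, Scheme.Hom.resLE_comp_ι]
  constructor
  · intro h
    let P : PrimeSpectrum Γ(X, U.carrier) := U.carrier.toSpecΓ x
    let Q : PrimeSpectrum Γ(X, U.carrier) := U.carrier.toSpecΓ y
    have hPQ : P.asIdeal.under U.invariants = Q.asIdeal.under U.invariants := by
      simp only [toQuotient] at h
      exact congrArg PrimeSpectrum.asIdeal h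
    -- `G` acts transitively on the primes over a given prime of the invariant ring.
    obtain ⟨g, hg⟩ := Algebra.IsInvariant.exists_smul_of_under_eq U.invariants _ G _ _ hPQ
    refine ⟨g, ?_⟩
    rw [key]
    congr 1
    apply U.carrier.toSpecΓ.isOpenEmbedding.injective
    rw [← Scheme.Hom.comp_apply, ← Scheme.Opens.toSpecΓ_SpecMap_appLE]
    refine PrimeSpectrum.ext (Ideal.ext fun s => ?_)
    change (ρ.hom g).appLE U.carrier U.carrier (U.isInvariantOpen _) s ∈ P.asIdeal ↔ s ∈ Q.asIdeal
    rw [hg, Ideal.mem_pointwise_smul_iff_inv_smul_mem, smul_def]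
    simp only [inv_inv]
  · rintro ⟨g, hg⟩
    rw [key] at hg
    rw [← U.carrier.ι.isOpenEmbedding.injective hg, ← Scheme.Hom.comp_apply, resLE_toQuotient]

end Finite

end InvariantAffineOpen

end SchemeGroupAction

/-- An injective local isomorphism is an open immersion. -/
lemma AlgebraicGeometry.IsLocalIso.isOpenImmersion_of_injective {X Y : Scheme.{u}} (f : X ⟶ Y)
    [IsLocalIso f] (hf : Function.Injective f) : IsOpenImmersion f := by
  have hopen : IsOpenMap f := isOpenMap_iff_nhds_le.mpr fun x => by
    obtain ⟨U, hxU, hU⟩ := IsLocalIso.exists_isOpenImmersion (f := f) x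
    refine ((U.ι ≫ f).isOpenEmbedding.isOpenMap.nhds_le ⟨x, hxU⟩).trans ?_
    rw [Scheme.Hom.comp_base, TopCat.coe_comp, ← Filter.map_map]
    exact Filter.map_mono (U.ι.continuous.tendsto _)
  have (x : X) : IsIso (f.stalkMap x) := by
    obtain ⟨U, hxU, hU⟩ := IsLocalIso.exists_isOpenImmersion (f := f) x
    let y : U.toScheme := ⟨x, hxU⟩
    have : IsIso (f.stalkMap (U.ι y) ≫ U.ι.stalkMap y) := by
      rw [← Scheme.Hom.stalkMap_comp]
      exact (IsOpenImmersion.iff_isIso_stalkMap.mp hU).2 y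
    have : IsIso (U.ι.stalkMap y) := (IsOpenImmersion.iff_isIso_stalkMap.mp inferInstance).2 y
    exact IsIso.of_isIso_comp_right (f.stalkMap (U.ι y)) (U.ι.stalkMap y)
  exact .of_isIso_stalkMap f (.of_continuous_injective_isOpenMap f.continuous hf hopen)

/-! ### Transition maps between the affine quotients. -/

namespace SchemeGroupAction

variable {G : Type w} [Group G] {X : Scheme.{u}} {ρ : SchemeGroupAction G X}

namespace InvariantAffineOpen

/-- The nonvanishing locus of an invariant function. -/
noncomputable def basicOpen (V : ρ.InvariantAffineOpen) (h : V.invariants) :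
    ρ.InvariantAffineOpen where
  carrier := X.basicOpen h.1
  isAffineOpen := V.isAffineOpen.basicOpen _
  isInvariantOpen g := by
    have := Scheme.basicOpen_appLE (ρ.hom g) _ _ (V.isInvariantOpen g) h.1
    rw [V.appLE_invariant] at this
    exact this.le.trans inf_le_right

lemma basicOpen_le (V : ρ.InvariantAffineOpen) (h : V.invariants) : V.basicOpen h ≤ V :=
  X.basicOpen_le _

variable [Finite G]

/-- The quotient map is closed, so the complement of `W` has closed image; as `W` is a union of
orbits, that image misses the image of `x`. A basic open separating the two is given by an invariant
function. -/
lemma exists_basicOpen_le (V : ρ.InvariantAffineOpen) {W : X.Opens} (hW : ρ.IsInvariantOpen W)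
    {x : X} (hxV : x ∈ V.carrier) (hxW : x ∈ W) :
    ∃ h : V.invariants, x ∈ X.basicOpen h.1 ∧ X.basicOpen h.1 ≤ W := by
  let Z : Set V.carrier.toScheme := (V.carrier.ι ⁻¹ᵁ W)ᶜ
  have hZ : IsClosed (V.toQuotient '' Z) :=
    V.toQuotient.isClosedMap _ (V.carrier.ι ⁻¹ᵁ W).isOpen.isClosed_compl
  have hx : V.toQuotient ⟨x, hxV⟩ ∈ (⟨_, hZ.isOpen_compl⟩ : ((quotientFunctor ρ).obj V).Opens) := by
    rintro ⟨y, hy, hxy⟩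
    obtain ⟨g, hg⟩ := (V.toQuotient_apply_eq_iff _ _).mp hxy
    exact hy ((hW.hom_apply_mem_iff g).mp (hg ▸ hxW))
  obtain ⟨_, ⟨h, rfl⟩, hxh, hle⟩ := Opens.isBasis_iff_nbhd.mp PrimeSpectrum.isBasis_basic_opens hx
  have key (y : V.carrier.toScheme) : V.toQuotient y ∈ PrimeSpectrum.basicOpen h ↔
      V.carrier.ι y ∈ X.basicOpen h.1 := by
    rw [← V.isAffineOpen.toSpecΓ_fromSpec, Scheme.Hom.comp_apply, ← Scheme.Hom.mem_preimage,
      V.isAffineOpen.fromSpec_preimage_basicOpen]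
    rfl
  refine ⟨h, (key _).mp hxh, fun y hy => ?_⟩
  by_contra hyW
  let y' : V.carrier.toScheme := ⟨y, X.basicOpen_le _ hy⟩
  exact hle ((key y').mpr hy) ⟨y', hyW, rfl⟩

lemma isOpenImmersion_of_eq_basicOpen {U V : ρ.InvariantAffineOpen} (hUV : U ⟶ V)
    (h : V.invariants) (e : U.carrier = X.basicOpen h.1) :
    IsOpenImmersion ((quotientFunctor ρ).map hUV) := by
  have := isLocalizationAway_fixedPointsMap (G := G)
    (X.presheaf.map (homOfLE (le_def.mp hUV.le)).op).hom (map_smul hUV.le) h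
    (V.isAffineOpen.isLocalization_of_eq_basicOpen h.1 _ e)
  let := (restrict hUV.le).toAlgebra
  exact IsOpenImmersion.of_isLocalization h

/-- It is a local isomorphism because both quotients share small basic opens, where invariants
commute with localization. It is injective because fibres are orbits in `X`, whichever chart they
are seen in. -/
instance {U V : ρ.InvariantAffineOpen} (h : U ⟶ V) :
    IsOpenImmersion ((quotientFunctor ρ).map h) := by
  have : IsLocalIso ((quotientFunctor ρ).map h) := by
    refine ⟨fun y => ?_⟩
    obtain ⟨x, rfl⟩ := U.toQuotient.surjective y
    obtain ⟨s, hxs, hs⟩ := V.exists_basicOpen_le U.isInvariantOpen (x := U.carrier.ι x)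
      (h.le x.2) x.2
    let D := V.basicOpen s
    let x' : D.carrier.toScheme := ⟨U.carrier.ι x, hxs⟩
    let i : D ⟶ U := homOfLE hs
    have h1 : IsOpenImmersion ((quotientFunctor ρ).map i) :=
      isOpenImmersion_of_eq_basicOpen i (restrict h.le s)
        ((Scheme.basicOpen_res _ _ _).trans (inf_eq_right.mpr hs)).symm
    have h2 : IsOpenImmersion ((quotientFunctor ρ).map (i ≫ h)) :=
      isOpenImmersion_of_eq_basicOpen _ s rfl
    refine ⟨((quotientFunctor ρ).map i).opensRange, ⟨D.toQuotient x', ?_⟩, ?_⟩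
    · rw [quotientFunctor_map_toQuotient_apply]
      congr 1
      exact U.carrier.ι.isOpenEmbedding.injective congr($(X.homOfLE_ι hs) x')
    · rw [← MorphismProperty.cancel_left_of_respectsIso @IsOpenImmersion
        ((quotientFunctor ρ).map i).isoOpensRange.hom, Scheme.Hom.isoOpensRange_hom_ι_assoc,
        ← Functor.map_comp]
      exact h2
  refine IsLocalIso.isOpenImmersion_of_injective _ fun y z hyz => ?_
  obtain ⟨y, rfl⟩ := U.toQuotient.surjective y
  obtain ⟨z, rfl⟩ := U.toQuotient.surjective z
  rw [quotientFunctor_map_toQuotient_apply, quotientFunctor_map_toQuotient_apply,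
    toQuotient_apply_eq_iff] at hyz
  rw [toQuotient_apply_eq_iff]
  simpa only [← Scheme.Hom.comp_apply, Scheme.homOfLE_ι] using hyz

end InvariantAffineOpen

end SchemeGroupAction

/-! ### Gluing the quotient. -/

namespace SchemeGroupAction

variable {G : Type w} [Group G] {X : Scheme.{u}} {ρ : SchemeGroupAction G X}

open InvariantAffineOpen

/-- The intersection of two invariant affine open subsets of a separated scheme. -/
def InvariantAffineOpen.inf [X.IsSeparated] (U V : ρ.InvariantAffineOpen) :
    ρ.InvariantAffineOpen where
  carrier := U.carrier ⊓ V.carrier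
  isAffineOpen := U.isAffineOpen.inf V.isAffineOpen
  isInvariantOpen := U.isInvariantOpen.inf V.isInvariantOpen

section

variable (hρ : ∀ x : X, ∃ U : ρ.InvariantAffineOpen, x ∈ U.carrier)

/-- The open cover of `X` by invariant affine open subsets. -/
noncomputable def invariantCover : X.OpenCover :=
  X.openCoverOfIsOpenCover (fun U : ρ.InvariantAffineOpen => U.carrier)
    (IsOpenCover.mk (Opens.ext (Set.eq_univ_of_forall fun x => by simpa using hρ x)))

lemma hom_ext_of_invariantAffineOpen
    (hρ : ∀ x : X, ∃ U : ρ.InvariantAffineOpen, x ∈ U.carrier) {Z : Scheme.{u}} {f g : X ⟶ Z}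
    (h : ∀ U : ρ.InvariantAffineOpen, U.carrier.ι ≫ f = U.carrier.ι ≫ g) : f = g :=
  (invariantCover hρ).hom_ext _ _ h

end

variable [X.IsSeparated] [Finite G]

/-- This is the gluing condition: points with the same image come from one orbit, which lies in the
invariant affine open `U ⊓ V`. -/
instance : (quotientFunctor ρ ⋙ Scheme.forget).IsLocallyDirected where
  cond {U V W} f g y z h := by
    obtain ⟨y, rfl⟩ := U.toQuotient.surjective y
    obtain ⟨z, rfl⟩ := V.toQuotient.surjective z
    change (quotientFunctor ρ).map f (U.toQuotient y) =
      (quotientFunctor ρ).map g (V.toQuotient z) at h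
    rw [quotientFunctor_map_toQuotient_apply, quotientFunctor_map_toQuotient_apply,
      toQuotient_apply_eq_iff] at h
    obtain ⟨a, ha⟩ := h
    simp only [← Scheme.Hom.comp_apply, Scheme.homOfLE_ι] at ha
    have hz : V.carrier.ι z ∈ U.carrier := by
      rw [← ha, Scheme.Hom.comp_apply]
      exact U.isInvariantOpen a y.2
    let i : U.inf V ⟶ U := homOfLE (le_def.mpr inf_le_left)
    let j : U.inf V ⟶ V := homOfLE (le_def.mpr inf_le_right)
    let t : (U.inf V).carrier.toScheme := ⟨V.carrier.ι z, hz, z.2⟩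
    refine ⟨U.inf V, i, j, (U.inf V).toQuotient t, ?_, ?_⟩
    · change (quotientFunctor ρ).map i _ = _
      rw [quotientFunctor_map_toQuotient_apply, eq_comm, toQuotient_apply_eq_iff]
      exact ⟨a, ha.trans congr($(X.homOfLE_ι i.le) t).symm⟩
    · change (quotientFunctor ρ).map j _ = _
      rw [quotientFunctor_map_toQuotient_apply]
      congr 1
      exact V.carrier.ι.isOpenEmbedding.injective congr($(X.homOfLE_ι j.le) t)

variable (ρ) in
/-- The quotient of a scheme by a finite group, glued from the spectra of the rings of invariants
of the invariant affine open subsets. -/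
noncomputable def quotient : Scheme.{u} := colimit (quotientFunctor ρ)

/-- The inclusion of the quotient of an invariant affine open subset. -/
noncomputable def quotientι (U : ρ.InvariantAffineOpen) :
    (quotientFunctor ρ).obj U ⟶ ρ.quotient := colimit.ι (quotientFunctor ρ) U

instance (U : ρ.InvariantAffineOpen) : IsOpenImmersion (quotientι U) :=
  inferInstanceAs (IsOpenImmersion (colimit.ι (quotientFunctor ρ) U))

lemma map_quotientι {U V : ρ.InvariantAffineOpen} (f : U ⟶ V) :
    (quotientFunctor ρ).map f ≫ quotientι V = quotientι U :=
  colimit.w (quotientFunctor ρ) f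

variable (ρ) in
/-- The affine open cover of the quotient. -/
noncomputable def quotientCover : ρ.quotient.OpenCover :=
  Scheme.IsLocallyDirected.openCover (quotientFunctor ρ)

instance [IsReduced X] : IsReduced ρ.quotient := by
  have (i : ρ.quotientCover.I₀) : AlgebraicGeometry.IsReduced (ρ.quotientCover.X i) := by
    let U : ρ.InvariantAffineOpen := i
    have : _root_.IsReduced U.invariants :=
      isReduced_of_injective U.invariants.subtype Subtype.val_injective
    exact inferInstanceAs (AlgebraicGeometry.IsReduced (Spec (CommRingCat.of U.invariants)))
  exact AlgebraicGeometry.IsReduced.of_openCover _ ρ.quotientCover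

lemma toQuotient_quotientι_compatible (U V : ρ.InvariantAffineOpen) :
    pullback.fst U.carrier.ι V.carrier.ι ≫ U.toQuotient ≫ quotientι U =
      pullback.snd U.carrier.ι V.carrier.ι ≫ V.toQuotient ≫ quotientι V := by
  have h := isPullback_opens_inf U.carrier V.carrier
  rw [← cancel_epi h.isoPullback.hom, h.isoPullback_hom_fst_assoc, h.isoPullback_hom_snd_assoc]
  let i : U.inf V ⟶ U := homOfLE (le_def.mpr inf_le_left)
  let j : U.inf V ⟶ V := homOfLE (le_def.mpr inf_le_right)
  have hi := homOfLE_toQuotient i =≫ quotientι U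
  have hj := homOfLE_toQuotient j =≫ quotientι V
  simp only [Category.assoc, map_quotientι] at hi hj
  exact hi.trans hj.symm

variable (hρ : ∀ x : X, ∃ U : ρ.InvariantAffineOpen, x ∈ U.carrier)

/-- The quotient map. -/
noncomputable def quotientMap : X ⟶ ρ.quotient :=
  (invariantCover hρ).glueMorphisms (fun U => U.toQuotient ≫ quotientι U)
    toQuotient_quotientι_compatible

lemma ι_quotientMap (U : ρ.InvariantAffineOpen) :
    U.carrier.ι ≫ quotientMap hρ = U.toQuotient ≫ quotientι U :=
  (invariantCover hρ).ι_glueMorphisms _ _ U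

lemma quotientMap_apply_eq (U : ρ.InvariantAffineOpen) (x : U.carrier.toScheme) :
    quotientMap hρ (U.carrier.ι x) = quotientι U (U.toQuotient x) :=
  congr($(ι_quotientMap hρ U) x)

/-- Points identified in the colimit come from a common smaller chart `W ≤ U`, so `x` is a translate
of a point of `U`. -/
lemma mem_of_quotientMap_mem (U : ρ.InvariantAffineOpen) {x : X}
    (h : quotientMap hρ x ∈ Set.range (quotientι U)) : x ∈ U.carrier := by
  obtain ⟨y, hy⟩ := h
  obtain ⟨V, hxV⟩ := hρ x
  let x' : V.carrier.toScheme := ⟨x, hxV⟩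
  have hy := hy.trans (quotientMap_apply_eq hρ V x')
  obtain ⟨W, f, g, z, -, hz⟩ := (Scheme.IsLocallyDirected.ι_eq_ι_iff _).mp hy
  obtain ⟨z, rfl⟩ := W.toQuotient.surjective z
  rw [quotientFunctor_map_toQuotient_apply, toQuotient_apply_eq_iff] at hz
  obtain ⟨a, ha⟩ := hz
  have hz : V.carrier.ι (X.homOfLE g.le z) = W.carrier.ι z := congr($(X.homOfLE_ι g.le) z)
  rw [hz] at ha
  have hx : ρ.hom a (W.carrier.ι z) ∈ U.carrier := U.isInvariantOpen a (f.le z.2)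
  rw [ha] at hx
  exact hx

/-- Charts being saturated, the quotient map restricts over each of them to `U.toQuotient`, so
target-local properties can be read off there. -/
lemma isPullback_quotientMap (U : ρ.InvariantAffineOpen) :
    IsPullback U.carrier.ι U.toQuotient (quotientMap hρ) (quotientι U) := by
  have H (s : PullbackCone (quotientMap hρ) (quotientι U)) :
      Set.range s.fst ⊆ Set.range U.carrier.ι := by
    rintro _ ⟨x, rfl⟩
    rw [Scheme.Opens.range_ι]
    exact mem_of_quotientMap_mem hρ U ⟨s.snd x, congr($s.condition x).symm⟩
  refine ⟨⟨ι_quotientMap hρ U⟩, ⟨PullbackCone.IsLimit.mk _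
    (fun s => IsOpenImmersion.lift U.carrier.ι s.fst (H s))
    (fun s => IsOpenImmersion.lift_fac _ _ _) (fun s => ?_) (fun s m h1 h2 => ?_)⟩⟩
  · rw [← cancel_mono (quotientι U), Category.assoc, ← ι_quotientMap hρ U,
      IsOpenImmersion.lift_fac_assoc, s.condition]
  · rw [← cancel_mono U.carrier.ι, IsOpenImmersion.lift_fac, h1]

instance : Surjective (quotientMap hρ) := by
  refine ⟨fun y => ?_⟩
  obtain ⟨U, y, rfl⟩ := Scheme.IsLocallyDirected.ι_jointly_surjective _ y
  obtain ⟨x, rfl⟩ := U.toQuotient.surjective y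
  exact ⟨_, quotientMap_apply_eq hρ U x⟩

lemma universallyClosed_snd_quotientMap (U : ρ.InvariantAffineOpen) :
    UniversallyClosed (pullback.snd (quotientMap hρ) (quotientι U)) := by
  rw [← (isPullback_quotientMap hρ U).isoPullback_inv_snd]
  infer_instance

instance : UniversallyClosed (quotientMap hρ) :=
  IsZariskiLocalAtTarget.of_openCover (P := @UniversallyClosed) ρ.quotientCover
    (universallyClosed_snd_quotientMap hρ)

lemma hom_quotientMap (g : G) : ρ.hom g ≫ quotientMap hρ = quotientMap hρ := by
  refine hom_ext_of_invariantAffineOpen hρ fun U => ?_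
  rw [← Category.assoc, ← Scheme.Hom.resLE_comp_ι (ρ.hom g) (U.isInvariantOpen g), Category.assoc,
    ι_quotientMap, ← Category.assoc, resLE_toQuotient]

end SchemeGroupAction

/-! ### Factoring invariant morphisms through the quotient. -/

namespace SchemeGroupAction

variable {G : Type w} [Group G] {X : Scheme.{u}} {ρ : SchemeGroupAction G X}

open InvariantAffineOpen

section Desc

variable {Z : Scheme.{u}} {f : X ⟶ Z} (hf : ∀ g, ρ.hom g ≫ f = f)

lemma InvariantAffineOpen.appLE_mem_invariants (hf : ∀ g, ρ.hom g ≫ f = f)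
    (W : ρ.InvariantAffineOpen) {V : Z.Opens}
    (e : W.carrier ≤ f ⁻¹ᵁ V) (s : Γ(Z, V)) : f.appLE V W.carrier e s ∈ W.invariants := by
  rw [mem_invariants_iff]
  intro g
  rw [← CommRingCat.comp_apply, Scheme.Hom.appLE_comp_appLE]
  simp only [hf]

/-- The ring map corresponding to an invariant morphism to an affine scheme. -/
noncomputable def InvariantAffineOpen.descRingHom (W : ρ.InvariantAffineOpen) {V : Z.Opens}
    (e : W.carrier ≤ f ⁻¹ᵁ V) : Γ(Z, V) ⟶ CommRingCat.of W.invariants :=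
  CommRingCat.ofHom ((f.appLE V W.carrier e).hom.codRestrict _ (W.appLE_mem_invariants hf e))

lemma InvariantAffineOpen.descRingHom_inclusion (W : ρ.InvariantAffineOpen) {V : Z.Opens}
    (e : W.carrier ≤ f ⁻¹ᵁ V) : W.descRingHom hf e ≫ W.inclusion = f.appLE V W.carrier e := rfl

lemma InvariantAffineOpen.exists_toQuotient_comp_eq (hf : ∀ g, ρ.hom g ≫ f = f)
    (W : ρ.InvariantAffineOpen) {V : Z.Opens} (hV : IsAffineOpen V) (e : W.carrier ≤ f ⁻¹ᵁ V) :
    ∃ α : (quotientFunctor ρ).obj W ⟶ Z, W.toQuotient ≫ α = W.carrier.ι ≫ f := by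
  refine ⟨Spec.map (W.descRingHom hf e) ≫ hV.fromSpec, ?_⟩
  rw [← W.isAffineOpen.toSpecΓ_fromSpec, Category.assoc,
    ← hV.SpecMap_appLE_fromSpec f W.isAffineOpen e, ← W.descRingHom_inclusion hf e, Spec.map_comp]
  exact Category.assoc _ _ _

variable [X.IsSeparated] [Finite G] (hρ : ∀ x : X, ∃ U : ρ.InvariantAffineOpen, x ∈ U.carrier)

lemma comp_desc_eq (U : ρ.InvariantAffineOpen) {α : (quotientFunctor ρ).obj U ⟶ Z}
    (hα : U.toQuotient ≫ α = U.carrier.ι ≫ f) {R : Scheme.{u}} {r : R ⟶ X}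
    {t : R ⟶ (quotientFunctor ρ).obj U} (h : r ≫ quotientMap hρ = t ≫ quotientι U) :
    t ≫ α = r ≫ f := by
  have H := isPullback_quotientMap hρ U
  have h1 := H.lift_fst r t h
  have h2 := H.lift_snd r t h
  generalize H.lift r t h = l at h1 h2
  rw [← h1, ← h2, Category.assoc, Category.assoc, hα]

/-- The overlap is reduced and `Z` separated, so agreement may be tested after the surjective base
change of the quotient map, where both sides become `f`. -/
lemma pullback_fst_desc_eq [IsReduced X] [Z.IsSeparated] (U V : ρ.InvariantAffineOpen)
    {α : (quotientFunctor ρ).obj U ⟶ Z} (hα : U.toQuotient ≫ α = U.carrier.ι ≫ f)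
    {β : (quotientFunctor ρ).obj V ⟶ Z} (hβ : V.toQuotient ≫ β = V.carrier.ι ≫ f)
    (hρ : ∀ x : X, ∃ U : ρ.InvariantAffineOpen, x ∈ U.carrier) :
    pullback.fst (quotientι U) (quotientι V) ≫ α =
      pullback.snd (quotientι U) (quotientι V) ≫ β := by
  let p : pullback (quotientι U) (quotientι V) ⟶ ρ.quotient :=
    pullback.fst (quotientι U) (quotientι V) ≫ quotientι U
  have : IsReduced (pullback (quotientι U) (quotientι V)) := isReduced_of_isOpenImmersion p
  refine ext_of_isDominant (pullback.snd (quotientMap hρ) p) ?_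
  have h := pullback.condition (f := quotientMap hρ) (g := p)
  rw [← Category.assoc, ← Category.assoc,
    comp_desc_eq hρ U hα (h.trans (Category.assoc _ _ _).symm), comp_desc_eq hρ V hβ]
  rw [h, Category.assoc, ← pullback.condition (f := quotientι U)]

/-- An invariant morphism to a separated scheme factors through the quotient. -/
lemma exists_quotientMap_comp_eq [IsReduced X] [Z.IsSeparated] (hf : ∀ g, ρ.hom g ≫ f = f) :
    ∃ α : ρ.quotient ⟶ Z, quotientMap hρ ≫ α = f := by
  -- Preimages of affine opens of `Z` are invariant, so `W` can be shrunk until `f` maps it into an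
  -- affine; there the factorization is a statement about rings.
  have key (x : X) : ∃ W : ρ.InvariantAffineOpen, x ∈ W.carrier ∧
      ∃ α : (quotientFunctor ρ).obj W ⟶ Z, W.toQuotient ≫ α = W.carrier.ι ≫ f := by
    obtain ⟨V, hV, hxV, -⟩ := exists_isAffineOpen_mem_and_subset (x := f x) (U := ⊤) trivial
    obtain ⟨U, hxU⟩ := hρ x
    obtain ⟨h, hxh, hh⟩ := U.exists_basicOpen_le (isInvariantOpen_preimage hf V) hxU hxV
    exact ⟨U.basicOpen h, hxh, (U.basicOpen h).exists_toQuotient_comp_eq hf hV hh⟩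
  choose W hxW α hα using key
  let C : ρ.quotient.OpenCover := Scheme.Cover.mkOfCovers X
    (fun x => (quotientFunctor ρ).obj (W x)) (fun x => quotientι (W x)) (fun y => by
      obtain ⟨x, rfl⟩ := (quotientMap hρ).surjective y
      exact ⟨x, _, (quotientMap_apply_eq hρ (W x) ⟨x, hxW x⟩).symm⟩)
    (fun x => inferInstanceAs (IsOpenImmersion (quotientι (W x))))
  have hC : ∀ x y : X, pullback.fst (quotientι (W x)) (quotientι (W y)) ≫ α x =
      pullback.snd (quotientι (W x)) (quotientι (W y)) ≫ α y :=
    fun x y => pullback_fst_desc_eq (W x) (W y) (hα x) (hα y) hρ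
  let β : ρ.quotient ⟶ Z := C.glueMorphisms α hC
  have hβ (x : X) : quotientι (W x) ≫ β = α x := C.ι_glueMorphisms α hC x
  refine ⟨β, ?_⟩
  let D : X.OpenCover := X.openCoverOfIsOpenCover (fun x => (W x).carrier)
    (IsOpenCover.mk (Opens.ext (Set.eq_univ_of_forall fun x => by simpa using ⟨x, hxW x⟩)))
  have hD (x : X) : (W x).carrier.ι ≫ quotientMap hρ ≫ β = (W x).carrier.ι ≫ f := by
    rw [← Category.assoc, ι_quotientMap, Category.assoc, hβ, hα]
  exact D.hom_ext _ _ hD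

lemma quotient_hom_ext [IsReduced X] [Z.IsSeparated] {α β : ρ.quotient ⟶ Z}
    (h : quotientMap hρ ≫ α = quotientMap hρ ≫ β) : α = β :=
  ext_of_isDominant (quotientMap hρ) h

end Desc

end SchemeGroupAction

/-! ### Seminormality of schemes versus rings of sections. -/

section Seminormal

lemma AlgebraicGeometry.IsAffineOpen.isSeminormalRing_stalk {X : Scheme.{u}} {U : X.Opens}
    (hU : IsAffineOpen U) [IsDomain Γ(X, U)] (h : IsSeminormalRing Γ(X, U)) (x : U) :
    IsSeminormalRing (X.presheaf.stalk x.1) := by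
  have := hU.isLocalization_stalk x
  exact .isLocalization _ (hU.primeIdealOf x).asIdeal.primeCompl_le_nonZeroDivisors h

lemma IsSeminormalScheme.isSeminormalRing {X : Scheme.{u}} (hX : IsSeminormalScheme X)
    {U : X.Opens} (hU : IsAffineOpen U) [IsDomain Γ(X, U)] : IsSeminormalRing Γ(X, U) := by
  refine .of_localizations fun p _ => ?_
  let y : PrimeSpectrum Γ(X, U) := ⟨p, inferInstance⟩
  have hy : hU.fromSpec y ∈ U := hU.opensRange_fromSpec.le ⟨y, rfl⟩
  let := TopCat.Presheaf.algebra_section_stalk X.presheaf ⟨hU.fromSpec y, hy⟩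
  have : IsLocalization p.primeCompl (X.presheaf.stalk (hU.fromSpec y)) :=
    hU.isLocalization_stalk' y hy
  exact (hX (hU.fromSpec y)).of_ringEquiv
    (IsLocalization.algEquiv p.primeCompl _ (Localization.AtPrime p)).toRingEquiv

lemma IsSeminormalRing.isSeminormalScheme_Spec {R : CommRingCat.{u}} [IsDomain R]
    (h : IsSeminormalRing R) : IsSeminormalScheme (Spec R) := fun x => by
  let e := (Scheme.ΓSpecIso R).symm.commRingCatIsoToRingEquiv
  have : IsDomain Γ(Spec R, ⊤) := e.symm.toMulEquiv.isDomain R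
  exact (isAffineOpen_top (Spec R)).isSeminormalRing_stalk (h.of_ringEquiv e) ⟨x, trivial⟩

end Seminormal

/-! ### Descending properties along a surjective first factor. -/

section Morphisms

variable {X Y S : Scheme.{u}} (f : X ⟶ Y) (g : Y ⟶ S)

lemma AlgebraicGeometry.QuasiCompact.of_comp_surjective [Surjective f] [QuasiCompact (f ≫ g)] :
    QuasiCompact g := by
  refine ⟨fun U hU hU' => ?_⟩
  have h := (QuasiCompact.isCompact_preimage (f := f ≫ g) U hU hU').image f.continuous
  have e : (f ≫ g) ⁻¹' U = f ⁻¹' (g ⁻¹' U) := rfl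
  rwa [e, Set.image_preimage_eq _ f.surjective] at h

/-- The diagonal of `f ≫ g` followed by `f × f` is `f` followed by the diagonal of `g`. The former
is universally closed, and surjectivity of `f` passes this to the diagonal of `g`. -/
lemma AlgebraicGeometry.IsSeparated.of_comp_universallyClosed [Surjective f] [UniversallyClosed f]
    [IsSeparated (f ≫ g)] : IsSeparated g := by
  let p := pullback.map (f ≫ g) (f ≫ g) g g f f (𝟙 S) (by simp) (by simp)
  have : UniversallyClosed p :=
    MorphismProperty.pullbackMap (P := @UniversallyClosed) ‹_› ‹_› rfl rfl
  have h : f ≫ pullback.diagonal g = pullback.diagonal (f ≫ g) ≫ p := by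
    have h1 : p ≫ pullback.fst g g = pullback.fst _ _ ≫ f := pullback.lift_fst _ _ _
    have h2 : p ≫ pullback.snd g g = pullback.snd _ _ ≫ f := pullback.lift_snd _ _ _
    apply pullback.hom_ext
    · rw [Category.assoc, Category.assoc, h1, pullback.diagonal_fst, pullback.diagonal_fst_assoc,
        Category.comp_id]
    · rw [Category.assoc, Category.assoc, h2, pullback.diagonal_snd, pullback.diagonal_snd_assoc,
        Category.comp_id]
  have : UniversallyClosed (f ≫ pullback.diagonal g) := by
    rw [h]
    infer_instance
  have : UniversallyClosed (pullback.diagonal g) := .of_comp_surjective f _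
  exact ⟨.of_isPreimmersion _ (pullback.diagonal g).isClosedMap.isClosed_range⟩

end Morphisms

/-! ### Seminormality and finite type of the quotient; existence of the invariant cover. -/

namespace SchemeGroupAction

variable {G : Type w} [Group G] [Finite G] {X : Scheme.{u}} [X.IsSeparated]
  {ρ : SchemeGroupAction G X}

open InvariantAffineOpen

variable (hρ : ∀ x : X, ∃ U : ρ.InvariantAffineOpen, x ∈ U.carrier)

lemma isSeminormalScheme_quotient [AlgebraicGeometry.IsIntegral X] (hX : IsSeminormalScheme X) :
    IsSeminormalScheme ρ.quotient := fun y => by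
  obtain ⟨U, z, rfl⟩ := Scheme.IsLocallyDirected.ι_jointly_surjective _ y
  obtain ⟨x, rfl⟩ := U.toQuotient.surjective z
  have : Nonempty U.carrier := ⟨x⟩
  have : IsSeminormalScheme (Spec (.of U.invariants)) :=
    (hX.isSeminormalRing U.isAffineOpen).fixedPoints.isSeminormalScheme_Spec
  exact (this (U.toQuotient x)).of_ringEquiv
    (asIso ((quotientι U).stalkMap (U.toQuotient x))).symm.commRingCatIsoToRingEquiv

lemma locallyOfFiniteType_of_quotientMap_comp {R : CommRingCat.{u}} [IsNoetherianRing R]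
    (t : ρ.quotient ⟶ Spec R) [LocallyOfFiniteType (quotientMap hρ ≫ t)] :
    LocallyOfFiniteType t := by
  have key (U : ρ.InvariantAffineOpen) : LocallyOfFiniteType (quotientι U ≫ t) := by
    obtain ⟨φ, hφ⟩ : ∃ φ : R ⟶ .of U.invariants, Spec.map φ = quotientι U ≫ t :=
      ⟨_, Spec.map_preimage _⟩
    have h : Spec.map (φ ≫ U.inclusion) =
        inv U.carrier.toSpecΓ ≫ U.carrier.ι ≫ quotientMap hρ ≫ t := by
      rw [IsIso.eq_inv_comp, ← Category.assoc, ι_quotientMap, Category.assoc, ← hφ, Spec.map_comp,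
        ← Category.assoc]
      rfl
    have : LocallyOfFiniteType (Spec.map (φ ≫ U.inclusion)) := by
      rw [h]
      infer_instance
    rw [← hφ]
    exact (HasRingHomProperty.Spec_iff (P := @LocallyOfFiniteType)).mpr
      (finiteType_fixedPoints φ.hom
        ((HasRingHomProperty.Spec_iff (P := @LocallyOfFiniteType)).mp this))
  have : IsZariskiLocalAtSource @LocallyOfFiniteType.{u} :=
    HasRingHomProperty.instIsZariskiLocalAtSource (Q := RingHom.FiniteType)
  exact IsZariskiLocalAtSource.of_openCover (P := @LocallyOfFiniteType) ρ.quotientCover key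

end SchemeGroupAction

lemma IsSeminormalScheme.of_isIso {X Y : Scheme.{u}} (hX : IsSeminormalScheme X) (f : Y ⟶ X)
    [IsIso f] : IsSeminormalScheme Y := fun y =>
  (hX (f y)).of_ringEquiv (asIso (f.stalkMap y)).commRingCatIsoToRingEquiv

namespace SchemeGroupAction

variable {G : Type w} [Group G] {X : Scheme.{u}} (ρ : SchemeGroupAction G X)

lemma hom_comp_hom_inv (g : G) : ρ.hom g ≫ ρ.hom g⁻¹ = 𝟙 X := by
  rw [← ρ.hom_mul, inv_mul_cancel, ρ.hom_one]

instance (g : G) : IsIso (ρ.hom g) :=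
  ⟨ρ.hom g⁻¹, ρ.hom_comp_hom_inv g, by simpa using ρ.hom_comp_hom_inv g⁻¹⟩

/-- If every orbit is contained in an affine open subset, then the invariant affine open subsets
form a cover. -/
lemma exists_invariantAffineOpen [Finite G] [X.IsSeparated]
    (h : ∀ s : Finset X, ∃ U : X.Opens, IsAffineOpen U ∧ ∀ x ∈ s, x ∈ U) (x : X) :
    ∃ U : ρ.InvariantAffineOpen, x ∈ U.carrier := by
  classical
  cases nonempty_fintype G
  obtain ⟨U, hU, hxU⟩ := h (Finset.univ.image fun g => ρ.hom g x)
  have hmem (y : X) : y ∈ ⨅ g, ρ.hom g ⁻¹ᵁ U ↔ ∀ g, ρ.hom g y ∈ U := by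
    rw [← SetLike.mem_coe, Opens.coe_iInf]
    simp
  refine ⟨⟨⨅ g, ρ.hom g ⁻¹ᵁ U, .iInf fun g => hU.preimage_of_isIso (ρ.hom g), ?_⟩, ?_⟩
  · intro g y hy
    rw [Scheme.Hom.mem_preimage, hmem]
    intro a
    rw [← Scheme.Hom.comp_apply, ← ρ.hom_mul]
    exact (hmem y).mp hy _
  · exact (hmem x).mpr fun g => hxU _ (Finset.mem_image_of_mem _ (Finset.mem_univ g))

end SchemeGroupAction

/-! ### Passing between `Sch/k` and schemes; the categorical quotient. -/

namespace SchOver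

variable {k : Type u} [Field k]

instance (X : SchOver k) : AlgebraicGeometry.IsSeparated X.structureHom := X.property.1

instance (X : SchOver k) : LocallyOfFiniteType X.structureHom := X.property.2.1

instance (X : SchOver k) : QuasiCompact X.structureHom := X.property.2.2

instance (X : SchOver k) : X.scheme.IsSeparated := by
  rw [Scheme.isSeparated_iff, ← terminal.comp_from X.structureHom]
  infer_instance

lemma schemeHom_structureHom {X Y : SchOver k} (f : X ⟶ Y) :
    schemeHom f ≫ Y.structureHom = X.structureHom := Over.w f.hom

lemma schemeHom_injective {X Y : SchOver k} :
    Function.Injective (schemeHom : (X ⟶ Y) → (X.scheme ⟶ Y.scheme)) :=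
  fun _ _ h => ObjectProperty.hom_ext _ (Over.OverMorphism.ext h)

/-- An object of `Sch/k` from its structure morphism. -/
noncomputable def mk {X : Scheme.{u}} (f : X ⟶ Spec (CommRingCat.of k))
    [AlgebraicGeometry.IsSeparated f] [LocallyOfFiniteType f] [QuasiCompact f] : SchOver k :=
  ⟨Over.mk f, ‹_›, ‹_›, ‹_›⟩

/-- A morphism of `Sch/k` from a morphism of schemes over `k`. -/
noncomputable def homMk {X Y : SchOver k} (f : X.scheme ⟶ Y.scheme)
    (hf : f ≫ Y.structureHom = X.structureHom) : X ⟶ Y :=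
  ObjectProperty.homMk (Over.homMk f hf)

/-- Open and closed subschemes. -/
noncomputable def ofIsClosed (X : SchOver k) (U : X.scheme.Opens)
    (hU : IsClosed (U : Set X.scheme)) : SchOver k :=
  have : IsClosedImmersion U.ι := .of_isPreimmersion _ (by simpa using hU)
  mk (U.ι ≫ X.structureHom)

end SchOver

namespace SchemeAction

variable {k : Type u} [Field k] {G : Type w} [Group G] {X : SchOver k} (σ : SchemeAction G X)

lemma comp_act_const {T : SchOver k} (g : G) (x : T ⟶ X) :
    x ≫ σ.act (LocallyConstant.const _ g) (𝟙 X) = σ.act (LocallyConstant.const _ g) x := by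
  rw [σ.comp_act, Category.comp_id]
  rfl

/-- The action of the abstract group `G` on the underlying scheme. -/
noncomputable def toSchemeGroupAction : SchemeGroupAction G X.scheme where
  hom g := SchOver.schemeHom (σ.act (LocallyConstant.const _ g) (𝟙 X))
  hom_one := congrArg SchOver.schemeHom (σ.one_act (𝟙 X))
  hom_mul g h := by
    have := (σ.comp_act_const g (σ.act (LocallyConstant.const _ h) (𝟙 X))).trans
      (σ.mul_act _ _ (𝟙 X)).symm
    exact (congrArg SchOver.schemeHom this).symm

lemma schemeHom_act_const {T : SchOver k} (g : G) (x : T ⟶ X) :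
    SchOver.schemeHom (σ.act (LocallyConstant.const _ g) x) =
      SchOver.schemeHom x ≫ σ.toSchemeGroupAction.hom g :=
  congrArg SchOver.schemeHom (σ.comp_act_const g x).symm

/-- A point `g` of the constant group is constant on its fibres, which are open and closed, hence
again in `Sch/k`, and cover `T`. So constant points suffice. -/
lemma isInvariant_iff {Y : SchOver k} (q : X ⟶ Y) :
    σ.IsInvariant q ↔ ∀ g, σ.toSchemeGroupAction.hom g ≫ SchOver.schemeHom q =
      SchOver.schemeHom q := by
  refine ⟨fun h g => (congrArg SchOver.schemeHom (h X (LocallyConstant.const _ g) (𝟙 X))).trans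
    (congrArg SchOver.schemeHom (Category.id_comp q)), fun h T g x => ?_⟩
  let U (a : G) : T.scheme.Opens := ⟨g ⁻¹' {a}, g.isLocallyConstant.isOpen_fiber a⟩
  have hU (a : G) : IsClosed (U a : Set T.scheme) := g.isLocallyConstant.isClosed_fiber a
  let C : T.scheme.OpenCover := T.scheme.openCoverOfIsOpenCover U
    (IsOpenCover.mk (Opens.ext (Set.eq_univ_of_forall fun x => Opens.mem_iSup.mpr ⟨g x, rfl⟩)))
  refine SchOver.schemeHom_injective (C.hom_ext _ _ ?_)
  have key (a : G) : (U a).ι ≫ SchOver.schemeHom (σ.act g x ≫ q) =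
      (U a).ι ≫ SchOver.schemeHom (x ≫ q) := by
    let j : T.ofIsClosed (U a) (hU a) ⟶ T := SchOver.homMk (U a).ι rfl
    have hj : ConstGroupPoints.pullback j g = LocallyConstant.const _ a :=
      LocallyConstant.ext fun y => y.2
    have := congrArg SchOver.schemeHom (σ.comp_act j g x)
    rw [hj, schemeHom_act_const] at this
    have e : SchOver.schemeHom (j ≫ σ.act g x) ≫ SchOver.schemeHom q =
        SchOver.schemeHom (j ≫ x) ≫ SchOver.schemeHom q := by
      rw [this, Category.assoc, h]
    exact (Category.assoc _ _ _).symm.trans (e.trans (Category.assoc _ _ _))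
  exact key

variable {σ}

lemma IsCategoricalQuotient.exists_isIso {Y Y' : SchOver k} {q : X ⟶ Y} {q' : X ⟶ Y'}
    (hq : σ.IsCategoricalQuotient q) (hq' : σ.IsCategoricalQuotient q') :
    ∃ f : Y ⟶ Y', IsIso f := by
  obtain ⟨f, hf, -⟩ := hq.universal Y' q' hq'.invariant
  obtain ⟨g, hg, -⟩ := hq'.universal Y q hq.invariant
  refine ⟨f, g, (hq.universal Y q hq.invariant).unique ?_ (Category.comp_id q),
    (hq'.universal Y' q' hq'.invariant).unique ?_ (Category.comp_id q')⟩
  · rw [← Category.assoc, hf, hg]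
  · rw [← Category.assoc, hg, hf]

variable (σ)

theorem exists_isCategoricalQuotient [Finite G] [AlgebraicGeometry.IsIntegral X.scheme]
    (hX : IsQuasiProjective X) (h : IsSeminormalScheme X.scheme) :
    ∃ (Y : SchOver k) (q : X ⟶ Y), σ.IsCategoricalQuotient q ∧ IsSeminormalScheme Y.scheme := by
  let ρ := σ.toSchemeGroupAction
  have hρ := ρ.exists_invariantAffineOpen hX.exists_isAffineOpen
  obtain ⟨t, ht⟩ := ρ.exists_quotientMap_comp_eq hρ (f := X.structureHom)
    fun g => SchOver.schemeHom_structureHom _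
  have : AlgebraicGeometry.IsSeparated (ρ.quotientMap hρ ≫ t) := by rw [ht]; infer_instance
  have : LocallyOfFiniteType (ρ.quotientMap hρ ≫ t) := by rw [ht]; infer_instance
  have : QuasiCompact (ρ.quotientMap hρ ≫ t) := by rw [ht]; infer_instance
  have := IsSeparated.of_comp_universallyClosed (ρ.quotientMap hρ) t
  have := ρ.locallyOfFiniteType_of_quotientMap_comp hρ t
  have := QuasiCompact.of_comp_surjective (ρ.quotientMap hρ) t
  let Y : SchOver k := SchOver.mk t
  let q : X ⟶ Y := SchOver.homMk (ρ.quotientMap hρ) ht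
  refine ⟨Y, q, ⟨(σ.isInvariant_iff q).mpr (ρ.hom_quotientMap hρ), fun Z q' hq' => ?_⟩,
    ρ.isSeminormalScheme_quotient h⟩
  obtain ⟨α, hα⟩ := ρ.exists_quotientMap_comp_eq hρ ((σ.isInvariant_iff q').mp hq')
  -- Compatibility with the structure morphisms holds after composing with the quotient map, which
  -- can be cancelled since `Spec k` is separated.
  have hα' : α ≫ Z.structureHom = t := SchemeGroupAction.quotient_hom_ext hρ (by
    rw [← Category.assoc, hα, ht, SchOver.schemeHom_structureHom])
  refine ⟨SchOver.homMk α hα', SchOver.schemeHom_injective hα, fun β hβ => ?_⟩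
  exact SchOver.schemeHom_injective (SchemeGroupAction.quotient_hom_ext hρ
    ((congrArg SchOver.schemeHom hβ).trans hα.symm))

end SchemeAction

theorem mainTheorem9 {k : Type u} [Field k] {G : Type w} [Group G] [Finite G] :
    (∀ (X : SchOver k) (σ : SchemeAction G X), AlgebraicGeometry.IsIntegral X.scheme →
      IsQuasiProjective X → IsSeminormalScheme X.scheme →
        (∃ (Y : SchOver k) (q : X ⟶ Y), σ.IsCategoricalQuotient q) ∧
        ∀ (Y : SchOver k) (q : X ⟶ Y), σ.IsCategoricalQuotient q →
          IsSeminormalScheme Y.scheme) ∧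
    (∀ (A : Type v) [CommRing A] [IsDomain A] [MulSemiringAction G A], IsSeminormalRing A →
      IsSeminormalRing (FixedPoints.subring A G)) := by
  refine ⟨fun X σ _ hX h => ?_, fun A _ _ _ h => h.fixedPoints⟩
  obtain ⟨Y, q, hq, hY⟩ := σ.exists_isCategoricalQuotient hX h
  refine ⟨⟨Y, q, hq⟩, fun Y' q' hq' => ?_⟩
  obtain ⟨f, _⟩ := hq'.exists_isIso hq
  have : IsIso (SchOver.schemeHom f) := inferInstanceAs (IsIso ((Over.forget _).map f.hom))
  exact hY.of_isIso (SchOver.schemeHom f)
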